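/- Let $D\subset\mathbb R^k$ be a convex polyhedral set (an intersection of finitely many closed half-spaces) and let $N_D:\mathbb R^k\rightrightarrows\mathbb R^k$ be its normal cone mapping: $N_D(d)=\{d^*\mid \langle d^*,y-d\rangle\le 0\ \ \forall y\in D\}$ for $d\in D$, and $N_D(d)=\emptyset$ for $d\notin D$. Notation. ${\rm Lim\,sup}$ denotes the Painlevé–Kuratowski outer set limit. For $A\subset\mathbb R^s$ and $x\in A$ let $T_A(x)={\rm Lim\,sup}_{t\downarrow0}(A-x)/t$ be the contingent cone, $\widehat N_A(x)=\{v\mid\langle v,u\rangle\le0\ \ \forall u\in T_A(x)\}$ the regular normal cone, and $T^\sharp_A(x)={\rm Lim\,sup}_{x'\to x,\,x'\in A}T_A(x')$ the outer limiting tangent cone. The set $A$ is semismooth$^*$ at $x\in A$ if for every $\epsilon>0$ there is $\delta>0$ such that $|\langle v,x'-x\rangle|\le\epsilon\|x'-x\|\,\|v\|$ for all $x'\in A$ with $\|x'-x\|\le\delta$ and all $v\in\widehat N_A(x')$; a set-valued mapping is semismooth$^*$ at a point of its graph if its graph is. Let $\mathcal Z_{nm}$ be the set of $n$-dimensional linear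 subspaces of $\mathbb R^{n}\times\mathbb R^{m}$ with the metric $\|P_{L_1}-P_{L_2}\|$, where $P_L$ is the orthogonal projection onto $L$ and $\|\cdot\|$ the operator norm for the Euclidean norm. For $F:\mathbb R^n\rightrightarrows\mathbb R^m$ let $\mathcal O_F$ be the set of all $(u,v)\in{\rm gph}\,F$ with $T_{{\rm gph}F}(u,v)\in\mathcal Z_{nm}$, and let ${\rm gph}\,\widehat D^*F(u,v)=\{(v^*,u^*)\mid(u^*,-v^*)\in\widehat N_{{\rm gph}F}(u,v)\}$. Then $\mathcal SF(x,y)$ is the set of all $L\in\mathcal Z_{nm}$ for which there are $(x_j,y_j)\in\mathcal O_F$ converging to $(x,y)$ with $T_{{\rm gph}F}(x_j,y_j)\to L$ in $\mathcal Z_{nm}$, and $\mathcal S^*F(x,y)$ is the set of all $L^*\in\mathcal Z_{mn}$ for which there are $(x_j,y_j)\in\mathcal O_F$ converging to $(x,y)$ with ${\rm gph}\,\widehat D^*F(x_j,y_j)\to L^*$ in $\mathcal Z_{mn}$. $F$ is an SCD mapping if $\mathcal S^*F(x,y)\neq\emptyset$ for all $(x,y)\in{\rm gph}\,F$. For $d^*\in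 N_D(d)$ let $\mathcal K_D(d,d^*)=T_D(d)\cap\{u\mid\langle u,d^*\rangle=0\}$ be the critical cone. A face of a convex set $K$ is a nonempty convex subset $\mathcal F\subset K$ such that every segment in $K$ having a relative interior point in $\mathcal F$ has both endpoints in $\mathcal F$. For a set $A$, $A^\perp$ is the set of vectors orthogonal to all elements of $A$. Proposition 5.3. The mapping $N_D$ is an SCD mapping and is semismooth$^*$ at every point of its graph. Further, for every $(d,d^*)\in{\rm gph}\,N_D$, $$\mathcal SN_D(d,d^*)=\mathcal S^*N_D(d,d^*)=\{(\mathcal F-\mathcal F)\times(\mathcal F-\mathcal F)^\perp\mid\mathcal F\text{ is a face of }\mathcal K_D(d,d^*)\},$$ and $T^\sharp_{{\rm gph}\,N_D}(d,d^*)$ is the union of all sets ${\rm gph}\,N_{\mathcal F_1-\mathcal F_2}$, where $\mathcal F_1,\mathcal F_2$ are faces of $\mathcal K_D(d,d^*)$ with $\mathcal F_2\subset\mathcal F_1$. -/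

import Mathlib

open Filter Topology
open scoped Pointwise RealInnerProductSpace

namespace SCD

/-- Euclidean space of dimension `n`. -/
abbrev Euc (n : ℕ) : Type := EuclideanSpace ℝ (Fin n)

/-- The product of two Euclidean spaces, with the norm `√(‖u‖² + ‖v‖²)`. -/
abbrev Prod2 (n m : ℕ) : Type := WithLp 2 (Euc n × Euc m)

/-- Painlevé-Kuratowski outer limit of the sets `S a` as `a` tends to the filter `l`, through
sequences. -/
def outerLim {α β : Type*} [TopologicalSpace β] (l : Filter α) (S : α → Set β) : Set β :=
  {y | ∃ (a : ℕ → α) (b : ℕ → β),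
    Tendsto a atTop l ∧ Tendsto b atTop (𝓝 y) ∧ ∀ j, b j ∈ S (a j)}

section Geometry

variable {E : Type*} [NormedAddCommGroup E] [InnerProductSpace ℝ E]

/-- The set of all vectors orthogonal to every element of `A`. -/
def orth (A : Set E) : Set E := {v | ∀ u ∈ A, ⟪u, v⟫ = 0}

/-- The negative polar of `A`. -/
def polar (A : Set E) : Set E := {v | ∀ u ∈ A, ⟪v, u⟫ ≤ 0}

/-- The tangent (contingent, Bouligand) cone to `A` at `x`: the outer limit of `(A - x) / t` as
`t ↓ 0`. -/
def tangentCone (A : Set E) (x : E) : Set E :=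
  outerLim (𝓝[>] (0 : ℝ)) (fun t => {u | x + t • u ∈ A})

/-- The outer limiting tangent cone to `A` at `x`. -/
def outerLimitingTangentCone (A : Set E) (x : E) : Set E :=
  outerLim (𝓝[A] x) (tangentCone A)

/-- The regular (Fréchet) normal cone to `A` at `x`. -/
def regularNormalCone (A : Set E) (x : E) : Set E := polar (tangentCone A x)

/-- The set `A` is semismooth* at `x`. -/
def SemismoothStarSetAt (A : Set E) (x : E) : Prop :=
  ∀ ε > 0, ∃ δ > 0, ∀ y ∈ A ∩ Metric.closedBall x δ, ∀ v ∈ regularNormalCone A y,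
    |⟪v, y - x⟫| ≤ ε * ‖y - x‖ * ‖v‖

/-- The normal cone of convex analysis to a convex set `D` at `x`; it is empty if `x ∉ D`. -/
def normalCone (D : Set E) (x : E) : Set E :=
  {v | x ∈ D ∧ ∀ y ∈ D, ⟪v, y - x⟫ ≤ 0}

/-- A convex polyhedral set: the intersection of finitely many closed half-spaces. -/
def IsConvexPolyhedral (D : Set E) : Prop :=
  ∃ (N : ℕ) (a : Fin N → E) (b : Fin N → ℝ), D = {x | ∀ i, ⟪a i, x⟫ ≤ b i}

/-- The critical cone to `D` at `d` for `d'`. -/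
def criticalCone (D : Set E) (d d' : E) : Set E := tangentCone D d ∩ orth {d'}

/-- `F` is a (nonempty) face of the convex set `K`: a nonempty convex subset of `K` such that every
segment in `K` with a relative interior point in `F` has its endpoints in `F`. -/
def IsFace (K F : Set E) : Prop := F.Nonempty ∧ Convex ℝ F ∧ IsExtreme ℝ K F

end Geometry

/-- The space of all `n`-dimensional subspaces of `ℝⁿ × ℝᵐ`. -/
def Zspace (n m : ℕ) : Type := {L : Submodule ℝ (Prod2 n m) // Module.finrank ℝ L = n}

/-- The orthogonal projection onto `L`. -/
noncomputable def Zspace.proj {n m : ℕ} (L : Zspace n m) : Prod2 n m →L[ℝ] Prod2 n m :=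
  L.1.starProjection

theorem Zspace.proj_injective (n m : ℕ) : Function.Injective (Zspace.proj (n := n) (m := m)) :=
  fun _ _ h => Subtype.ext (Submodule.starProjection_inj.1 h)

/-- The metric `d(L₁, L₂) = ‖P₁ - P₂‖`, with the operator norm of the difference of the orthogonal
projections. -/
noncomputable instance (n m : ℕ) : MetricSpace (Zspace n m) :=
  MetricSpace.induced Zspace.proj (Zspace.proj_injective n m) inferInstance

/-- The underlying set of a subspace. -/
def Zspace.toSet {n m : ℕ} (L : Zspace n m) : Set (Prod2 n m) := L.1

section Mappings

variable {n m : ℕ}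

/-- The graph of a set-valued mapping. -/
def gph (F : Euc n → Set (Euc m)) : Set (Prod2 n m) := {z | z.snd ∈ F z.fst}

/-- The set-valued mapping `F` is semismooth* at the point `p` of its graph. -/
def SemismoothStarAt (F : Euc n → Set (Euc m)) (p : Prod2 n m) : Prop :=
  SemismoothStarSetAt (gph F) p

/-- The graph of the graphical derivative of `F` at `p`. -/
def gphDeriv (F : Euc n → Set (Euc m)) (p : Prod2 n m) : Set (Prod2 n m) :=
  tangentCone (gph F) p

/-- The graph of the regular (Fréchet) coderivative of `F` at `p`: all pairs `(y*, x*)` such that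
`(x*, -y*)` is a regular normal to the graph of `F`. -/
def gphRegularCoderiv (F : Euc n → Set (Euc m)) (p : Prod2 n m) : Set (Prod2 m n) :=
  {w | WithLp.toLp 2 (w.snd, -w.fst) ∈ regularNormalCone (gph F) p}

/-- The points of the graph of `F` where `F` is graphically smooth of dimension `n`. -/
def smoothPoints (F : Euc n → Set (Euc m)) : Set (Prod2 n m) :=
  {p | p ∈ gph F ∧ ∃ L : Zspace n m, L.toSet = gphDeriv F p}

/-- The mapping which is `{gph DF(p)}` at points of graphical smoothness and empty elsewhere. -/
def primalHat (F : Euc n → Set (Euc m)) (p : Prod2 n m) : Set (Zspace n m) :=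
  {L | p ∈ smoothPoints F ∧ L.toSet = gphDeriv F p}

/-- The mapping which consists of the graph of the regular coderivative at points of graphical
smoothness and is empty elsewhere. -/
def dualHat (F : Euc n → Set (Euc m)) (p : Prod2 n m) : Set (Zspace m n) :=
  {L | p ∈ smoothPoints F ∧ L.toSet = gphRegularCoderiv F p}

/-- The SC limiting graphical derivative of `F`. -/
def limitingPrimal (F : Euc n → Set (Euc m)) (p : Prod2 n m) : Set (Zspace n m) :=
  outerLim (𝓝[gph F] p) (primalHat F)

/-- The SC limiting coderivative of `F`. -/
def limitingDual (F : Euc n → Set (Euc m)) (p : Prod2 n m) : Set (Zspace m n) :=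
  outerLim (𝓝[gph F] p) (dualHat F)

/-- `F` has the SCD property at every point of its graph. -/
def IsSCDMapping (F : Euc n → Set (Euc m)) : Prop :=
  ∀ p ∈ gph F, (limitingDual F p).Nonempty

/-- The product of a subset of `ℝⁿ` and a subset of `ℝᵐ`. -/
def prodSet (A : Set (Euc n)) (B : Set (Euc m)) : Set (Prod2 n m) :=
  {z | z.fst ∈ A ∧ z.snd ∈ B}

end Mappings

end SCD

open SCD

namespace SCD

section Geometry

variable {E : Type*} [NormedAddCommGroup E] [InnerProductSpace ℝ E]

/-! The heart of the matter is a local reduction: near a point (d, d*) of its graph, N_D is, up to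
translation, the normal cone mapping of the critical cone K, which is again polyhedral
(`IsConvexPolyhedral.eventually_mem_normalCone_iff`). As gph N_K is a closed cone, it is the tangent
cone to gph N_D at (d, d*).

Applying this twice, the tangent cone at a nearby point (d + u, d* + w) is gph N_C, where C is the
critical cone of K at u for w. These cones C are exactly the differences F₁ - F₂ of faces F₂ ⊆ F₁ of
K: F₁ is the face of K exposed by w and F₂ is the smallest face containing u
(`exists_face_criticalCone`, `exists_criticalCone_eq_sub`). Since (u, w) may be scaled down, each
difference occurs arbitrarily close to (d, d*). A polyhedral cone has finitely many faces, so an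
outer limit only collects finitely many closed candidates, each attained along a constant sequence.

If gph N_C is a subspace, then so is C; hence F₁ - F₂ = F₁ - F₁ and gph N_C = C × C^⊥. The regular
coderivative has this same graph, so the primal and dual limiting objects coincide. Semismoothness*
holds because z = (u, w) and -z are both tangent at (d + u, d* + w), so regular normals there are
orthogonal to z. -/

/-- The polyhedral cone cut out by the finitely many homogeneous inequalities `⟪a, u⟫ ≤ 0`. -/
def polyCone (s : Finset E) : Set E := {u | ∀ a ∈ s, ⟪a, u⟫ ≤ 0}

theorem zero_mem_polyCone (s : Finset E) : (0 : E) ∈ polyCone s := fun a _ => by simp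

theorem add_mem_polyCone {s : Finset E} {u v : E} (hu : u ∈ polyCone s) (hv : v ∈ polyCone s) :
    u + v ∈ polyCone s := fun a ha => by
  rw [inner_add_right]
  linarith [hu a ha, hv a ha]

theorem smul_mem_polyCone {s : Finset E} {t : ℝ} (ht : 0 ≤ t) {u : E} (hu : u ∈ polyCone s) :
    t • u ∈ polyCone s := fun a ha => by
  rw [inner_smul_right]
  exact mul_nonpos_of_nonneg_of_nonpos ht (hu a ha)

theorem convex_polyCone (s : Finset E) : Convex ℝ (polyCone s) :=
  fun _ hx _ hy _ _ ha hb _ => add_mem_polyCone (smul_mem_polyCone ha hx) (smul_mem_polyCone hb hy)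

theorem isClosed_polyCone (s : Finset E) : IsClosed (polyCone s) := by
  simp only [polyCone, Set.ofPred_forall]
  exact isClosed_iInter fun a => isClosed_iInter fun _ =>
    isClosed_le (by fun_prop) continuous_const

theorem isConvexPolyhedral_polyCone (s : Finset E) : IsConvexPolyhedral (polyCone s) := by
  refine ⟨s.card, fun i => s.equivFin.symm i, fun _ => 0, ?_⟩
  ext u
  refine ⟨fun h i => h _ (s.equivFin.symm i).2, fun h a ha => ?_⟩
  simpa using h (s.equivFin ⟨a, ha⟩)

theorem polyCone_inter_orth [DecidableEq E] (s : Finset E) (v : E) :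
    polyCone s ∩ orth {v} = polyCone (s ∪ {v, -v}) := by
  ext u
  simp only [polyCone, orth, Set.mem_inter_iff, Set.mem_ofPred_eq, Set.mem_singleton_iff,
    forall_eq, Finset.mem_union, Finset.mem_insert, Finset.mem_singleton]
  constructor
  · rintro ⟨h, h'⟩ a (ha | rfl | rfl)
    · exact h a ha
    · exact h'.le
    · rw [inner_neg_left, h', neg_zero]
  · intro h
    refine ⟨fun a ha => h a (Or.inl ha), le_antisymm (h v (by simp)) ?_⟩
    have := h (-v) (by simp)
    rw [inner_neg_left] at this
    linarith

/-- Testing a normal at x against 0 and 2x forces orthogonality to x. -/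
theorem mem_normalCone_polyCone {s : Finset E} {x v : E} :
    v ∈ normalCone (polyCone s) x ↔
      x ∈ polyCone s ∧ v ∈ polar (polyCone s) ∧ ⟪v, x⟫ = 0 := by
  constructor
  · rintro ⟨hx, h⟩
    have h0 := h 0 (zero_mem_polyCone s)
    have h2 := h (x + x) (add_mem_polyCone hx hx)
    simp only [zero_sub, inner_neg_right, add_sub_cancel_right] at h0 h2
    have hvx : ⟪v, x⟫ = 0 := by linarith
    refine ⟨hx, fun u hu => ?_, hvx⟩
    have := h u hu
    rw [inner_sub_right] at this
    linarith
  · rintro ⟨hx, hv, hvx⟩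
    refine ⟨hx, fun y hy => ?_⟩
    rw [inner_sub_right, hvx, sub_zero]
    exact hv y hy

/-! ### The Minkowski-Weyl theorem -/

/-- Base case of Minkowski-Weyl: a finite spanning set together with its negatives generates the
space as a cone. -/
theorem exists_finset_span_nnreal_eq_top [FiniteDimensional ℝ E] [DecidableEq E] :
    ∃ g : Finset E, Submodule.span NNReal (g : Set E) = ⊤ := by
  obtain ⟨B, hB⟩ := Module.Finite.fg_top (R := ℝ) (M := E)
  refine ⟨B ∪ B.image (fun b => -b), eq_top_iff.2 fun x hx' => ?_⟩
  clear hx'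
  set S := Submodule.span NNReal ((B ∪ B.image (fun b => -b) : Finset E) : Set E) with hS
  have hx : x ∈ Submodule.span ℝ (B : Set E) := by rw [hB]; trivial
  have key : x ∈ S ∧ -x ∈ S := by
    induction hx using Submodule.span_induction with
    | mem b hb =>
      refine ⟨Submodule.subset_span (by simp [Finset.mem_coe.1 hb]), Submodule.subset_span ?_⟩
      simp [Finset.mem_coe.1 hb]
    | zero => simp
    | add y z _ _ hy hz =>
      rw [neg_add]
      exact ⟨S.add_mem hy.1 hz.1, S.add_mem hy.2 hz.2⟩
    | smul r y _ hy =>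
      rcases le_total 0 r with hr | hr
      · have h1 := S.smul_mem (⟨r, hr⟩ : NNReal) hy.1
        have h2 := S.smul_mem (⟨r, hr⟩ : NNReal) hy.2
        exact ⟨h1, by rw [← smul_neg]; exact h2⟩
      · have h1 : (-r) • y ∈ S := S.smul_mem (⟨-r, by linarith⟩ : NNReal) hy.1
        have h2 : (-r) • -y ∈ S := S.smul_mem (⟨-r, by linarith⟩ : NNReal) hy.2
        simp only [neg_smul, smul_neg, neg_neg] at h1 h2
        exact ⟨h2, h1⟩
  exact key.1

theorem smul_mem_span_nnreal {g : Set E} {t : ℝ} (ht : 0 ≤ t) {u : E}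
    (hu : u ∈ Submodule.span NNReal g) : t • u ∈ Submodule.span NNReal g :=
  (Submodule.span NNReal g).smul_mem (⟨t, ht⟩ : NNReal) hu

theorem inner_nonpos_of_mem_span_nnreal {g : Set E} {a u : E} (h : ∀ x ∈ g, ⟪a, x⟫ ≤ 0)
    (hu : u ∈ Submodule.span NNReal g) : ⟪a, u⟫ ≤ 0 := by
  induction hu using Submodule.span_induction with
  | mem x hx => exact h x hx
  | zero => simp
  | add y z _ _ hy hz => rw [inner_add_right]; linarith
  | smul r y _ hy =>
    rw [NNReal.smul_def, inner_smul_right]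
    exact mul_nonpos_of_nonneg_of_nonpos r.2 hy

/-- The expression is bilinear in (n, p), so membership for pairs of generators extends to the cones
they generate. -/
theorem inner_smul_sub_inner_smul_mem {gn gp : Set E} {a : E} {S : Submodule NNReal E}
    (h : ∀ q ∈ gn, ∀ p ∈ gp, ⟪a, p⟫ • q - ⟪a, q⟫ • p ∈ S) {n p : E}
    (hn : n ∈ Submodule.span NNReal gn) (hp : p ∈ Submodule.span NNReal gp) :
    ⟪a, p⟫ • n - ⟪a, n⟫ • p ∈ S := by
  induction hn using Submodule.span_induction with
  | mem q hq =>
    induction hp using Submodule.span_induction with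
    | mem p hp => exact h q hq p hp
    | zero => simp
    | add y z _ _ hy hz =>
      convert Submodule.add_mem _ hy hz using 1
      rw [inner_add_right]
      module
    | smul r y _ hy =>
      convert Submodule.smul_mem _ r hy using 1
      simp only [NNReal.smul_def, inner_smul_right]
      module
  | zero => simp
  | add y z _ _ hy hz =>
    convert Submodule.add_mem _ hy hz using 1
    rw [inner_add_right]
    module
  | smul r y _ hy =>
    convert Submodule.smul_mem _ r hy using 1
    simp only [NNReal.smul_def, inner_smul_right]
    module

/-- Induction step of Minkowski-Weyl (double description): keep the generators inside the
half-space, and replace those outside by their positive combinations with inside ones that lie on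
the bounding hyperplane. -/
theorem exists_finset_span_nnreal_inter_halfspace [DecidableEq E] (g : Finset E) (a : E) :
    ∃ g' : Finset E, ∀ u, u ∈ Submodule.span NNReal (g' : Set E) ↔
      u ∈ Submodule.span NNReal (g : Set E) ∧ ⟪a, u⟫ ≤ 0 := by
  set gn := g.filter fun x => ⟪a, x⟫ ≤ 0 with hgn
  set gp := g.filter fun x => 0 < ⟪a, x⟫ with hgp
  set g' := gn ∪ Finset.image₂ (fun q p => ⟪a, p⟫ • q - ⟪a, q⟫ • p) gn gp with hg'
  refine ⟨g', fun u => ⟨fun hu => ⟨?_, ?_⟩, ?_⟩⟩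
  · refine Submodule.span_le.2 ?_ hu
    intro x hx
    rw [Finset.mem_coe, hg', Finset.mem_union, Finset.mem_image₂] at hx
    rcases hx with hx | ⟨q, hq, p, hp, rfl⟩
    · exact Submodule.subset_span (Finset.mem_coe.2 (Finset.mem_filter.1 hx).1)
    · rw [hgn, Finset.mem_filter] at hq
      rw [hgp, Finset.mem_filter] at hp
      rw [sub_eq_add_neg, ← neg_smul]
      exact Submodule.add_mem _
        (smul_mem_span_nnreal hp.2.le (Submodule.subset_span (Finset.mem_coe.2 hq.1)))
        (smul_mem_span_nnreal (by linarith) (Submodule.subset_span (Finset.mem_coe.2 hp.1)))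
  · refine inner_nonpos_of_mem_span_nnreal (fun x hx => ?_) hu
    rw [Finset.mem_coe, hg', Finset.mem_union, Finset.mem_image₂] at hx
    rcases hx with hx | ⟨q, hq, p, hp, rfl⟩
    · exact (Finset.mem_filter.1 hx).2
    · rw [inner_sub_right, inner_smul_right, inner_smul_right]
      exact le_of_eq (by ring)
  · rintro ⟨hu, hau⟩
    have hgg : (g : Set E) = (gn : Set E) ∪ gp := by
      ext x
      simp only [hgn, hgp, Set.mem_union, Finset.mem_coe, Finset.mem_filter]
      rcases le_or_gt ⟪a, x⟫ 0 with h | h <;> simp [h, not_lt_of_ge, not_le_of_gt]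
    rw [hgg, Submodule.span_union, Submodule.mem_sup] at hu
    obtain ⟨n, hn, p, hp, rfl⟩ := hu
    have hnS : n ∈ Submodule.span NNReal (g' : Set E) :=
      Submodule.span_mono (by rw [hg']; simp) hn
    have hcomb : ⟪a, p⟫ • n - ⟪a, n⟫ • p ∈ Submodule.span NNReal (g' : Set E) := by
      refine inner_smul_sub_inner_smul_mem (fun q hq p hp => ?_) hn hp
      refine Submodule.subset_span (Finset.mem_coe.2 ?_)
      rw [hg', Finset.mem_union]
      exact Or.inr (Finset.mem_image₂_of_mem hq hp)
    -- The outside generators are strictly positive on `a`, so this is the case split that makes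
    -- division by `⟪a, n⟫` legitimate below.
    have hpos : p = 0 ∨ 0 < ⟪a, p⟫ := by
      clear hau hcomb
      induction hp using Submodule.span_induction with
      | mem p hp => exact Or.inr (Finset.mem_filter.1 hp).2
      | zero => exact Or.inl rfl
      | add y z _ _ hy hz =>
        rcases hy with rfl | hy
        · simpa using hz
        · rcases hz with rfl | hz
          · simpa using Or.inr hy
          · rw [inner_add_right]
            exact Or.inr (add_pos hy hz)
      | smul r y _ hy =>
        rcases hy with rfl | hy
        · simp
        · rcases eq_or_ne r 0 with rfl | hr
          · simp
          · rw [NNReal.smul_def, inner_smul_right]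
            exact Or.inr (mul_pos (NNReal.coe_pos.2 (pos_iff_ne_zero.2 hr)) hy)
    rcases hpos with rfl | hpos
    · simpa using hnS
    · rw [inner_add_right] at hau
      have he : 0 < -⟪a, n⟫ := by linarith
      -- All of p is absorbed into the combination on the hyperplane; the remaining coefficient of n
      -- is nonnegative exactly because `⟪a, n + p⟫ ≤ 0`.
      have hdec : n + p = (1 - ⟪a, p⟫ / -⟪a, n⟫) • n +
          (1 / -⟪a, n⟫) • (⟪a, p⟫ • n - ⟪a, n⟫ • p) := by
        have hne : ⟪a, n⟫ ≠ 0 := by linarith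
        match_scalars <;> field_simp
        ring
      rw [hdec]
      refine Submodule.add_mem _ (smul_mem_span_nnreal ?_ hnS)
        (smul_mem_span_nnreal (by positivity) hcomb)
      rw [sub_nonneg, div_le_one he]
      linarith

/-- The **Minkowski-Weyl theorem**: polyhedral cones are finitely generated. -/
theorem exists_finset_span_nnreal_eq_polyCone [FiniteDimensional ℝ E] (s : Finset E) :
    ∃ g : Finset E, ∀ u, u ∈ Submodule.span NNReal (g : Set E) ↔ u ∈ polyCone s := by
  classical
  induction s using Finset.induction_on with
  | empty =>
    obtain ⟨g, hg⟩ := exists_finset_span_nnreal_eq_top (E := E)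
    exact ⟨g, fun u => by simp [hg, polyCone]⟩
  | insert a s _ ih =>
    obtain ⟨g, hg⟩ := ih
    obtain ⟨g', hg'⟩ := exists_finset_span_nnreal_inter_halfspace g a
    refine ⟨g', fun u => ?_⟩
    rw [hg', hg]
    simp [polyCone, and_comm]

/-- Local structure of the normal vectors to a polyhedral cone `T` near a normal `v`. -/
theorem eventually_normal_add_iff [FiniteDimensional ℝ E] {s : Finset E} {v : E}
    (hv : v ∈ polar (polyCone s)) :
    ∀ᶠ w in 𝓝 (0 : E), ∀ u, (u ∈ polyCone s ∧ v + w ∈ polar (polyCone s) ∧ ⟪v + w, u⟫ = 0) ↔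
      (u ∈ polyCone s ∩ orth {v} ∧ w ∈ polar (polyCone s ∩ orth {v}) ∧ ⟪w, u⟫ = 0) := by
  obtain ⟨g, hg⟩ := exists_finset_span_nnreal_eq_polyCone s
  -- Finitely many generators: a small perturbation of v keeps negative those products that are
  -- negative. The only generators that can be orthogonal to v + w are then those orthogonal to v.
  have hloc : ∀ᶠ w in 𝓝 (0 : E), ∀ x ∈ g, ⟪v, x⟫ < 0 → ⟪v + w, x⟫ < 0 := by
    rw [Filter.eventually_all_finset]
    intro x _
    by_cases hx : ⟪v, x⟫ < 0
    · have hc : Continuous fun w : E => ⟪v + w, x⟫ := by fun_prop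
      have := hc.continuousAt.eventually_lt (g := fun _ => (0 : ℝ)) (x₀ := (0 : E))
        continuousAt_const (by simpa using hx)
      filter_upwards [this] with w hw _ using hw
    · exact Eventually.of_forall fun w h => absurd h hx
  have hgT : ∀ x ∈ g, x ∈ polyCone s := fun x hx =>
    (hg x).1 (Submodule.subset_span (Finset.mem_coe.2 hx))
  filter_upwards [hloc] with w hw u
  constructor
  · rintro ⟨hu, hvw, h0⟩
    -- In a nonnegative combination of generators all products with v + w are nonpositive, so a zero
    -- total forces each term to vanish.
    have key : ⟪v + w, u⟫ ≤ 0 ∧ (⟪v + w, u⟫ = 0 → ⟪v, u⟫ = 0) := by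
      have hu' := (hg u).2 hu
      clear h0 hu
      induction hu' using Submodule.span_induction with
      | mem x hx =>
        refine ⟨hvw x (hgT x hx), fun h => ?_⟩
        by_contra hne
        exact (hw x hx (lt_of_le_of_ne (hv x (hgT x hx)) hne)).ne h
      | zero => simp
      | add y z _ _ hy hz =>
        rw [inner_add_right, inner_add_right]
        refine ⟨by linarith [hy.1, hz.1], fun h => ?_⟩
        rw [hy.2 (by linarith [hy.1, hz.1]), hz.2 (by linarith [hy.1, hz.1]), add_zero]
      | smul r y _ hy =>
        rw [NNReal.smul_def, inner_smul_right, inner_smul_right]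
        refine ⟨mul_nonpos_of_nonneg_of_nonpos r.2 hy.1, fun h => ?_⟩
        rcases mul_eq_zero.1 h with h | h
        · rw [h, zero_mul]
        · rw [hy.2 h, mul_zero]
    have hvu : ⟪v, u⟫ = 0 := key.2 h0
    refine ⟨⟨hu, by simpa [orth, real_inner_comm] using hvu⟩, fun y hy => ?_, ?_⟩
    · have h1 := hvw y hy.1
      have h2 : ⟪v, y⟫ = 0 := hy.2 v rfl
      rw [inner_add_left] at h1
      linarith
    · rw [inner_add_left] at h0
      linarith
  · rintro ⟨⟨hu, huv⟩, hwp, h0⟩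
    have hvu : ⟪v, u⟫ = 0 := huv v rfl
    refine ⟨hu, fun y hy => ?_, by rw [inner_add_left, hvu, h0, add_zero]⟩
    refine inner_nonpos_of_mem_span_nnreal (fun x hx => ?_) ((hg y).2 hy)
    rcases (hv x (hgT x hx)).lt_or_eq with h | h
    · exact (hw x hx h).le
    · rw [inner_add_left, h, zero_add]
      refine hwp x ⟨hgT x hx, ?_⟩
      rintro _ rfl
      exact h

/-! ### Outer limits, tangent and normal cones -/

theorem mem_outerLim_of_eventually {α β : Type*} [TopologicalSpace β] {l : Filter α}
    {S : α → Set β} {y : β} {a : ℕ → α} {b : ℕ → β} (ha : Tendsto a atTop l)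
    (hb : Tendsto b atTop (𝓝 y)) (h : ∀ᶠ j in atTop, b j ∈ S (a j)) : y ∈ outerLim l S := by
  obtain ⟨N, hN⟩ := eventually_atTop.1 h
  exact ⟨fun j => a (j + N), fun j => b (j + N), ha.comp (tendsto_add_atTop_nat N),
    hb.comp (tendsto_add_atTop_nat N), fun j => hN _ (by omega)⟩

theorem outerLim_subset_of_eventually {α β : Type*} [TopologicalSpace β] {l : Filter α}
    {S : α → Set β} {C : Set β} (hC : IsClosed C) (h : ∀ᶠ a in l, S a ⊆ C) :
    outerLim l S ⊆ C := by
  rintro y ⟨a, b, ha, hb, hab⟩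
  exact hC.mem_of_tendsto hb ((ha.eventually h).mono fun j hj => hj (hab j))

/-- The constant sequence y serves as the approximating sequence. -/
theorem mem_outerLim_of_frequently {α β : Type*} [TopologicalSpace β] {l : Filter α}
    [l.IsCountablyGenerated] {S : α → Set β} {y : β} (h : ∃ᶠ a in l, y ∈ S a) :
    y ∈ outerLim l S := by
  obtain ⟨a, ha, hya⟩ := exists_seq_forall_of_frequently h
  exact ⟨a, fun _ => y, ha, tendsto_const_nhds, hya⟩

theorem tangentCone_subset_of_eventually {A B : Set E} {x y : E}
    (h : ∀ᶠ z in 𝓝 (0 : E), x + z ∈ A ↔ y + z ∈ B) : tangentCone A x ⊆ tangentCone B y := by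
  rintro u ⟨t, b, ht, hb, hab⟩
  have h0 : Tendsto (fun j => t j • b j) atTop (𝓝 0) := by
    simpa using (tendsto_nhds_of_tendsto_nhdsWithin ht).smul hb
  exact mem_outerLim_of_eventually ht hb ((h0.eventually h).mono fun j hj => hj.1 (hab j))

theorem tangentCone_congr {A B : Set E} {x y : E}
    (h : ∀ᶠ z in 𝓝 (0 : E), x + z ∈ A ↔ y + z ∈ B) : tangentCone A x = tangentCone B y :=
  (tangentCone_subset_of_eventually h).antisymm
    (tangentCone_subset_of_eventually (h.mono fun _ hz => hz.symm))

theorem tangentCone_zero_of_cone {B : Set E} (hB : IsClosed B)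
    (hcone : ∀ t : ℝ, 0 < t → ∀ u, t • u ∈ B ↔ u ∈ B) : tangentCone B 0 = B := by
  apply Set.Subset.antisymm
  · refine outerLim_subset_of_eventually hB ?_
    filter_upwards [self_mem_nhdsWithin] with t ht u hu
    simpa [hcone t ht] using hu
  · intro u hu
    refine mem_outerLim_of_frequently (Eventually.frequently ?_)
    filter_upwards [self_mem_nhdsWithin] with t ht
    simpa [hcone t ht] using hu

/-- By convexity of B, any z in B can be moved along the segment towards y into the neighbourhood
where the sets agree, and the normal inequality scales. -/
theorem normalCone_subset_of_eventually {A B : Set E} (hB : Convex ℝ B) {x y : E}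
    (h : ∀ᶠ z in 𝓝 (0 : E), x + z ∈ A ↔ y + z ∈ B) : normalCone A x ⊆ normalCone B y := by
  rintro v ⟨hx, hv⟩
  have hy : y ∈ B := by simpa using h.self_of_nhds.1 (by simpa using hx)
  refine ⟨hy, fun z hz => ?_⟩
  have h0 : Tendsto (fun t : ℝ => t • (z - y)) (𝓝[>] 0) (𝓝 0) := by
    have : Continuous fun t : ℝ => t • (z - y) := by fun_prop
    simpa using (this.tendsto 0).mono_left nhdsWithin_le_nhds
  obtain ⟨t, ⟨ht, ht0⟩, ht1⟩ := (((h0.eventually h).and self_mem_nhdsWithin).and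
    (nhdsWithin_le_nhds (eventually_lt_nhds one_pos))).exists
  have hmem := ht.2 (hB.add_smul_sub_mem hy hz ⟨le_of_lt ht0, ht1.le⟩)
  have := hv _ hmem
  rw [add_sub_cancel_left, inner_smul_right] at this
  exact nonpos_of_mul_nonpos_right this ht0

theorem normalCone_congr {A B : Set E} (hA : Convex ℝ A) (hB : Convex ℝ B) {x y : E}
    (h : ∀ᶠ z in 𝓝 (0 : E), x + z ∈ A ↔ y + z ∈ B) : normalCone A x = normalCone B y :=
  (normalCone_subset_of_eventually hB h).antisymm
    (normalCone_subset_of_eventually hA (h.mono fun _ hz => hz.symm))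

/-! ### Convex polyhedral sets -/

theorem IsConvexPolyhedral.convex {D : Set E} (hD : IsConvexPolyhedral D) : Convex ℝ D := by
  obtain ⟨N, a, b, rfl⟩ := hD
  rw [Set.ofPred_forall]
  exact convex_iInter fun i => convex_halfSpace_le (IsLinearMap.mk (inner_add_right (a i))
    fun c x => inner_smul_right (a i) x c) (b i)

/-- Near each of its points, a convex polyhedral set is a translated polyhedral cone. -/
theorem IsConvexPolyhedral.exists_polyCone {D : Set E} (hD : IsConvexPolyhedral D) {d : E}
    (hd : d ∈ D) : ∃ s : Finset E, ∀ᶠ u in 𝓝 (0 : E), d + u ∈ D ↔ u ∈ polyCone s := by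
  classical
  obtain ⟨N, a, b, rfl⟩ := hD
  -- Only the constraints active at d matter locally; inactive ones stay strict.
  refine ⟨(Finset.univ.filter fun i => ⟪a i, d⟫ = b i).image a, ?_⟩
  have hloc : ∀ᶠ u in 𝓝 (0 : E), ∀ i, ⟪a i, d⟫ < b i → ⟪a i, d + u⟫ < b i := by
    rw [Filter.eventually_all]
    intro i
    by_cases hi : ⟪a i, d⟫ < b i
    · have hc : Continuous fun u : E => ⟪a i, d + u⟫ := by fun_prop
      have := hc.continuousAt.eventually_lt (g := fun _ => b i) (x₀ := (0 : E))
        continuousAt_const (by simpa using hi)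
      filter_upwards [this] with u hu _ using hu
    · exact Eventually.of_forall fun w h => absurd h hi
  filter_upwards [hloc] with u hu
  simp only [Set.mem_ofPred_eq, polyCone, Finset.mem_image, Finset.mem_filter, Finset.mem_univ,
    true_and, forall_exists_index, and_imp, forall_apply_eq_imp_iff₂]
  constructor
  · intro h i hi
    have := h i
    rw [inner_add_right, hi] at this
    linarith
  · intro h i
    rcases (hd i).lt_or_eq with hi | hi
    · exact (hu i hi).le
    · rw [inner_add_right, hi]
      linarith [h i hi]

theorem smul_mem_polyCone_iff {s : Finset E} {t : ℝ} (ht : 0 < t) {u : E} :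
    t • u ∈ polyCone s ↔ u ∈ polyCone s := by
  refine ⟨fun h => ?_, smul_mem_polyCone ht.le⟩
  simpa [smul_smul, ht.ne'] using smul_mem_polyCone (inv_nonneg.2 ht.le) h

theorem tangentCone_eq_polyCone {D : Set E} {d : E} {s : Finset E}
    (h : ∀ᶠ u in 𝓝 (0 : E), d + u ∈ D ↔ u ∈ polyCone s) : tangentCone D d = polyCone s := by
  rw [tangentCone_congr (y := 0) (B := polyCone s) (by simpa using h)]
  exact tangentCone_zero_of_cone (isClosed_polyCone s) fun t ht u => smul_mem_polyCone_iff ht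

/-- For polyhedral sets tangent directions are feasible directions; no limit is needed. -/
theorem IsConvexPolyhedral.mem_tangentCone_iff {D : Set E} (hD : IsConvexPolyhedral D) {d w : E}
    (hd : d ∈ D) : w ∈ tangentCone D d ↔ ∃ t : ℝ, 0 < t ∧ d + t • w ∈ D := by
  obtain ⟨s, hs⟩ := hD.exists_polyCone hd
  rw [tangentCone_eq_polyCone hs]
  have h0 (w : E) : Tendsto (fun t : ℝ => t • w) (𝓝[>] 0) (𝓝 0) := by
    have : Continuous fun t : ℝ => t • w := by fun_prop
    simpa using (this.tendsto 0).mono_left nhdsWithin_le_nhds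
  constructor
  · intro hw
    obtain ⟨t, ht, ht0⟩ := (((h0 w).eventually hs).and self_mem_nhdsWithin).exists
    exact ⟨t, ht0, ht.2 (smul_mem_polyCone (le_of_lt ht0) hw)⟩
  · rintro ⟨t, ht, hmem⟩
    obtain ⟨r, ⟨hr, hr0⟩, hr1⟩ := ((((h0 (t • w)).eventually hs).and self_mem_nhdsWithin).and
      (nhdsWithin_le_nhds (eventually_lt_nhds one_pos))).exists
    have := hr.1 (by simpa using hD.convex.add_smul_sub_mem hd hmem ⟨le_of_lt hr0, hr1.le⟩)
    rwa [smul_mem_polyCone_iff hr0, smul_mem_polyCone_iff ht] at this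

/-! ### Faces of polyhedral cones -/

theorem mem_orth_singleton {v u : E} : u ∈ orth {v} ↔ ⟪v, u⟫ = 0 := by
  simp [orth]

theorem IsFace.zero_mem {s : Finset E} {F : Set E} (hF : IsFace (polyCone s) F) : (0 : E) ∈ F := by
  obtain ⟨⟨f, hf⟩, _, he⟩ := hF
  -- f is the midpoint of 0 and 2f.
  refine he.left_mem_of_mem_openSegment (zero_mem_polyCone s)
    (smul_mem_polyCone (t := 2) (by norm_num) (he.subset hf)) hf ?_
  refine ⟨1 / 2, 1 / 2, by norm_num, by norm_num, by norm_num, ?_⟩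
  module

theorem IsFace.smul_mem {s : Finset E} {F : Set E} (hF : IsFace (polyCone s) F) {f : E}
    (hf : f ∈ F) {t : ℝ} (ht : 0 ≤ t) : t • f ∈ F := by
  rcases le_or_gt t 1 with h1 | h1
  · simpa using hF.2.1 hf hF.zero_mem ht (sub_nonneg.2 h1) (by ring)
  · have ht0 : 0 < t := by linarith
    refine hF.2.2.left_mem_of_mem_openSegment (smul_mem_polyCone ht (hF.2.2.subset hf))
      (zero_mem_polyCone s) hf ⟨1 / t, 1 - 1 / t, by positivity, ?_, by ring, ?_⟩
    · rw [sub_pos, div_lt_one ht0]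
      exact h1
    · rw [smul_zero, add_zero, smul_smul, one_div, inv_mul_cancel₀ ht0.ne', one_smul]

theorem IsFace.add_mem {s : Finset E} {F : Set E} (hF : IsFace (polyCone s) F) {f g : E}
    (hf : f ∈ F) (hg : g ∈ F) : f + g ∈ F := by
  have h : (1 / 2 : ℝ) • (2 : ℝ) • f + (1 / 2 : ℝ) • (2 : ℝ) • g ∈ F :=
    hF.2.1 (hF.smul_mem hf (by norm_num)) (hF.smul_mem hg (by norm_num)) (by norm_num)
      (by norm_num) (by norm_num)
  convert h using 1
  module

/-- x + y is the midpoint of 2x and 2y, so 2x lies in the face. -/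
theorem IsFace.left_mem_of_add_mem {s : Finset E} {F : Set E} (hF : IsFace (polyCone s) F)
    {x y : E} (hx : x ∈ polyCone s) (hy : y ∈ polyCone s) (hxy : x + y ∈ F) : x ∈ F := by
  have h2 : (2 : ℝ) • x ∈ F := by
    refine hF.2.2.left_mem_of_mem_openSegment (smul_mem_polyCone (by norm_num) hx)
      (smul_mem_polyCone (t := 2) (by norm_num) hy) hxy ?_
    refine ⟨1 / 2, 1 / 2, by norm_num, by norm_num, by norm_num, ?_⟩
    module
  convert hF.smul_mem h2 (t := 1 / 2) (by norm_num) using 1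
  module

theorem isFace_polyCone_inter_orth {s : Finset E} {w : E} (hw : w ∈ polar (polyCone s)) :
    IsFace (polyCone s) (polyCone s ∩ orth {w}) := by
  refine ⟨⟨0, zero_mem_polyCone s, by simp [orth]⟩, ?_, Set.inter_subset_left, ?_⟩
  · refine (convex_polyCone s).inter fun x hx y hy a b _ _ _ => ?_
    rw [mem_orth_singleton] at *
    rw [inner_add_right, inner_smul_right, inner_smul_right, hx, hy, mul_zero, mul_zero, add_zero]
  · rintro x hx y hy _ ⟨_, hz⟩ ⟨a, b, ha, hb, _, rfl⟩
    refine ⟨hx, ?_⟩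
    rw [mem_orth_singleton] at *
    rw [inner_add_right, inner_smul_right, inner_smul_right] at hz
    have h1 := hw x hx
    have h2 := mul_nonpos_of_nonneg_of_nonpos hb.le (hw y hy)
    refine le_antisymm h1 (nonneg_of_mul_nonneg_right ?_ ha)
    linarith

theorem isFace_polyCone_self (s : Finset E) : IsFace (polyCone s) (polyCone s) :=
  ⟨⟨0, zero_mem_polyCone s⟩, convex_polyCone s, IsExtreme.rfl⟩

/-- A face of a polyhedral cone is given by turning some of the inequalities into equalities, and
it has a point in its relative interior. -/
theorem IsFace.exists_eq {s : Finset E} {F : Set E} (hF : IsFace (polyCone s) F) :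
    ∃ J ⊆ s, F = {v | v ∈ polyCone s ∧ ∀ a ∈ J, ⟪a, v⟫ = 0} ∧
      ∃ u ∈ F, ∀ v ∈ F, ∃ c : ℝ, 0 < c ∧ c • u - v ∈ polyCone s := by
  classical
  set J := s.filter fun a => ∀ v ∈ F, ⟪a, v⟫ = 0 with hJ
  -- J collects the constraints vanishing on all of F. Summing one point of F per remaining
  -- constraint gives a point u where those are all strict.
  have hFK := hF.2.2.subset
  obtain ⟨u, huF, hu⟩ : ∃ u ∈ F, ∀ a ∈ s, a ∉ J → ⟪a, u⟫ < 0 := by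
    have hx : ∀ a, ∃ x ∈ F, a ∈ s → a ∉ J → ⟪a, x⟫ < 0 := by
      intro a
      by_cases ha : a ∈ s ∧ a ∉ J
      · have : ¬ ∀ v ∈ F, ⟪a, v⟫ = 0 := fun h => ha.2 (Finset.mem_filter.2 ⟨ha.1, h⟩)
        push Not at this
        obtain ⟨x, hx, hne⟩ := this
        exact ⟨x, hx, fun _ _ => lt_of_le_of_ne (hFK hx a ha.1) hne⟩
      · exact ⟨0, hF.zero_mem, fun h1 h2 => absurd ⟨h1, h2⟩ ha⟩
    choose x hxF hx using hx
    refine ⟨∑ a ∈ s, x a, Finset.sum_induction _ (· ∈ F) (fun _ _ => hF.add_mem) hF.zero_mem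
      fun a _ => hxF a, fun a ha haJ => ?_⟩
    rw [inner_sum]
    exact Finset.sum_neg' (fun b _ => hFK (hxF b) a ha) ⟨a, ha, hx a ha haJ⟩
  have hmain : ∀ v ∈ polyCone s, (∀ a ∈ J, ⟪a, v⟫ = 0) →
      ∃ c : ℝ, 0 < c ∧ c • u - v ∈ polyCone s := by
    intro v _ hvJ
    -- Constraints in J vanish at u and v; the others are strictly negative at u, so a large
    -- multiple of u dominates v.
    have hev : ∀ᶠ c : ℝ in atTop, ∀ a ∈ s, ⟪a, c • u - v⟫ ≤ 0 := by
      rw [Filter.eventually_all_finset]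
      intro a ha
      by_cases haJ : a ∈ J
      · refine Eventually.of_forall fun c => ?_
        rw [inner_sub_right, inner_smul_right, hvJ a haJ, (Finset.mem_filter.1 haJ).2 u huF]
        simp
      · filter_upwards [eventually_ge_atTop (⟪a, v⟫ / ⟪a, u⟫)] with c hc
        rw [div_le_iff_of_neg (hu a ha haJ)] at hc
        rw [inner_sub_right, inner_smul_right]
        linarith
    obtain ⟨c, hc, hc0⟩ := (hev.and (eventually_gt_atTop 0)).exists
    exact ⟨c, hc0, hc⟩
  have hFeq : F = {v | v ∈ polyCone s ∧ ∀ a ∈ J, ⟪a, v⟫ = 0} := by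
    ext v
    refine ⟨fun hv => ⟨hFK hv, fun a ha => (Finset.mem_filter.1 ha).2 v hv⟩, ?_⟩
    rintro ⟨hv, hvJ⟩
    obtain ⟨c, hc, hcu⟩ := hmain v hv hvJ
    exact hF.left_mem_of_add_mem hv hcu (by simpa using hF.smul_mem huF hc.le)
  refine ⟨J, Finset.filter_subset _ _, hFeq, u, huF, fun v hv => ?_⟩
  rw [hFeq] at hv
  exact hmain v hv.1 hv.2

theorem finite_setOf_isFace_polyCone (s : Finset E) : {F | IsFace (polyCone s) F}.Finite := by
  refine (s.powerset.finite_toSet.image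
    fun J : Finset E => {v | v ∈ polyCone s ∧ ∀ a ∈ J, ⟪a, v⟫ = 0}).subset ?_
  intro F hF
  obtain ⟨J, hJ, hFJ, _⟩ := IsFace.exists_eq hF
  exact ⟨J, Finset.mem_coe.2 (Finset.mem_powerset.2 hJ), hFJ.symm⟩

/-- Every face of a polyhedral cone is exposed. -/
theorem IsFace.exists_exposing {s : Finset E} {F : Set E} (hF : IsFace (polyCone s) F) :
    ∃ w ∈ polar (polyCone s), F = polyCone s ∩ orth {w} := by
  obtain ⟨J, hJ, hFJ, _⟩ := hF.exists_eq
  -- A sum of nonpositive terms vanishes only if every term does, so the sum of the constraint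
  -- vectors in J exposes F.
  refine ⟨∑ a ∈ J, a, fun v hv => ?_, ?_⟩
  · rw [sum_inner]
    exact Finset.sum_nonpos fun a ha => hv a (hJ ha)
  · rw [hFJ]
    ext v
    simp only [Set.mem_ofPred_eq, Set.mem_inter_iff, mem_orth_singleton, sum_inner]
    refine and_congr_right fun hv => ?_
    rw [Finset.sum_eq_zero_iff_of_nonpos fun a ha => hv a (hJ ha)]

/-- A multiple of u dominates each element of F, so subtracting F amounts to subtracting nonnegative
multiples of u, which yields the feasible directions at u. -/
theorem sub_eq_criticalCone {s : Finset E} {w u : E} {F : Set E}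
    (hF : IsFace (polyCone s) F) (hFw : F ⊆ orth {w}) (hu : u ∈ F)
    (hFu : ∀ v ∈ F, ∃ c : ℝ, 0 < c ∧ c • u - v ∈ polyCone s) :
    polyCone s ∩ orth {w} - F = criticalCone (polyCone s) u w := by
  have huK := hF.2.2.subset hu
  have huw := mem_orth_singleton.1 (hFw hu)
  ext x
  rw [criticalCone, Set.mem_inter_iff,
    (isConvexPolyhedral_polyCone s).mem_tangentCone_iff huK, mem_orth_singleton]
  constructor
  · rintro ⟨f, ⟨hf, hfw⟩, g, hg, rfl⟩
    obtain ⟨c, hc, hcg⟩ := hFu g hg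
    refine ⟨⟨1 / c, by positivity, ?_⟩, ?_⟩
    · have := smul_mem_polyCone (t := 1 / c) (by positivity) (add_mem_polyCone hcg hf)
      convert this using 1
      match_scalars <;> field_simp
    · rw [inner_sub_right, mem_orth_singleton.1 hfw, mem_orth_singleton.1 (hFw hg), sub_zero]
  · rintro ⟨⟨t, ht, hmem⟩, hxw⟩
    refine ⟨(1 / t) • (u + t • x), ⟨smul_mem_polyCone (by positivity) hmem, ?_⟩,
      (1 / t) • u, hF.smul_mem hu (by positivity), ?_⟩
    · rw [mem_orth_singleton, inner_smul_right, inner_add_right, inner_smul_right, huw, hxw]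
      simp
    · simp only
      match_scalars <;> field_simp
      ring

/-- The smallest face of the polyhedral cone orthogonal to `w` which contains `u`. -/
theorem exists_face_criticalCone {s : Finset E} {w u : E} (hw : w ∈ polar (polyCone s))
    (hu : u ∈ polyCone s) (huw : ⟪w, u⟫ = 0) :
    ∃ F₁ F₂ : Set E, IsFace (polyCone s) F₁ ∧ IsFace (polyCone s) F₂ ∧ F₂ ⊆ F₁ ∧
      criticalCone (polyCone s) u w = F₁ - F₂ := by
  have hF₁ := isFace_polyCone_inter_orth hw
  have hF₂ : IsFace (polyCone s)
      -- The smallest face containing u consists of the elements dominated by a positive multiple of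
      -- u.
      {f | f ∈ polyCone s ∩ orth {w} ∧ ∃ c : ℝ, 0 < c ∧ c • u - f ∈ polyCone s} := by
    refine ⟨⟨u, ⟨hu, mem_orth_singleton.2 huw⟩, 1, one_pos, ?_⟩, ?_, ?_, ?_⟩
    · simpa using zero_mem_polyCone s
    · rintro x ⟨hx, c, hc, hcx⟩ y ⟨hy, e, he, hey⟩ a b ha hb hab
      refine ⟨hF₁.2.1 hx hy ha hb hab, a * c + b * e, ?_, ?_⟩
      · rcases ha.eq_or_lt with rfl | ha
        · rw [zero_add] at hab
          simpa [hab] using he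
        · positivity
      · convert add_mem_polyCone (smul_mem_polyCone ha hcx) (smul_mem_polyCone hb hey) using 1
        module
    · exact fun f hf => hf.1.1
    · rintro x hx y hy z ⟨hz, c, hc, hcz⟩ hzxy
      refine ⟨hF₁.2.2.left_mem_of_mem_openSegment hx hy hz hzxy, ?_⟩
      obtain ⟨a, b, ha, hb, _, rfl⟩ := hzxy
      -- From c u - (a x + b y) in the cone, add b y and divide by a.
      refine ⟨c / a, by positivity, ?_⟩
      convert smul_mem_polyCone (t := 1 / a) (by positivity)
        (add_mem_polyCone hcz (smul_mem_polyCone hb.le hy)) using 1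
      match_scalars <;> field_simp
      ring
  refine ⟨_, _, hF₁, hF₂, fun f hf => hf.1, (sub_eq_criticalCone hF₂ (fun f hf => hf.1.2)
    ⟨⟨hu, mem_orth_singleton.2 huw⟩, 1, one_pos, ?_⟩ fun v hv => hv.2).symm⟩
  simpa using zero_mem_polyCone s

/-- Every difference `F₁ - F₂` of faces `F₂ ⊆ F₁` of a polyhedral cone is a critical cone. -/
theorem exists_criticalCone_eq_sub {s : Finset E} {F₁ F₂ : Set E} (hF₁ : IsFace (polyCone s) F₁)
    (hF₂ : IsFace (polyCone s) F₂) (h : F₂ ⊆ F₁) :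
    ∃ u ∈ polyCone s, ∃ w ∈ polar (polyCone s), ⟪w, u⟫ = 0 ∧
      ∀ t : ℝ, 0 < t → criticalCone (polyCone s) (t • u) (t • w) = F₁ - F₂ := by
  -- Take w exposing F₁ and u relatively interior to F₂; both properties survive positive scaling,
  -- which allows (t u, t w) to tend to 0.
  obtain ⟨w, hw, rfl⟩ := hF₁.exists_exposing
  obtain ⟨_, _, _, u, hu, huF⟩ := hF₂.exists_eq
  refine ⟨u, hF₂.2.2.subset hu, w, hw, mem_orth_singleton.1 (h hu).2, fun t ht => ?_⟩
  have ho : orth {w} = orth {t • w} := by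
    ext x
    simp [mem_orth_singleton, inner_smul_left, ht.ne']
  rw [ho]
  refine (sub_eq_criticalCone hF₂ (fun f hf => ho ▸ (h hf).2) (hF₂.smul_mem hu ht.le)
    fun v hv => ?_).symm
  obtain ⟨c, hc, hcv⟩ := huF v hv
  refine ⟨c / t, by positivity, ?_⟩
  rwa [smul_smul, div_mul_cancel₀ _ ht.ne']

/-- Every critical cone of a convex polyhedral set is a polyhedral cone. -/
theorem IsConvexPolyhedral.exists_criticalCone_eq {D : Set E} (hD : IsConvexPolyhedral D) {d : E}
    (hd : d ∈ D) (v : E) : ∃ s : Finset E, criticalCone D d v = polyCone s := by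
  classical
  obtain ⟨s, hs⟩ := hD.exists_polyCone hd
  exact ⟨_, by rw [criticalCone, tangentCone_eq_polyCone hs, polyCone_inter_orth]⟩

theorem isClosed_polar (A : Set E) : IsClosed (polar A) := by
  simp only [polar, Set.ofPred_forall]
  exact isClosed_iInter fun a => isClosed_iInter fun _ =>
    isClosed_le (by fun_prop) continuous_const

/-- Local reduction of the normal cone mapping of a convex polyhedral set to the normal cone
mapping of the critical cone. -/
theorem IsConvexPolyhedral.eventually_mem_normalCone_iff [FiniteDimensional ℝ E] {D : Set E}
    (hD : IsConvexPolyhedral D) {d v : E} (hv : v ∈ normalCone D d) :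
    ∀ᶠ z : E × E in 𝓝 0,
      v + z.2 ∈ normalCone D (d + z.1) ↔ z.2 ∈ normalCone (criticalCone D d v) z.1 := by
  classical
  obtain ⟨s, hs⟩ := hD.exists_polyCone hv.1
  have hloc : ∀ᶠ u in 𝓝 (0 : E), normalCone D (d + u) = normalCone (polyCone s) u := by
    filter_upwards [hs.eventually_nhds] with u hu
    refine normalCone_congr hD.convex (convex_polyCone s) ?_
    have : Tendsto (fun z => u + z) (𝓝 0) (𝓝 u) := by
      have : Continuous fun z : E => u + z := by fun_prop
      simpa using this.tendsto 0
    simpa [add_assoc] using this.eventually hu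
  have hv' : v ∈ polar (polyCone s) := by
    have := hloc.self_of_nhds
    rw [add_zero] at this
    rw [this, mem_normalCone_polyCone] at hv
    exact hv.2.1
  rw [Prod.zero_eq_mk, nhds_prod_eq]
  filter_upwards [hloc.prod_mk (eventually_normal_add_iff hv')]
  rintro ⟨u, w⟩ ⟨hu, hw⟩
  simp only at hu hw ⊢
  rw [hu, criticalCone, tangentCone_eq_polyCone hs, mem_normalCone_polyCone, hw u,
    polyCone_inter_orth, mem_normalCone_polyCone]

end Geometry

/-! ### The graph of the normal cone mapping -/

variable {k : ℕ}

theorem mem_gph_normalCone_polyCone {s : Finset (Euc k)} {z : Prod2 k k} :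
    z ∈ gph (normalCone (polyCone s)) ↔
      z.fst ∈ polyCone s ∧ z.snd ∈ polar (polyCone s) ∧ ⟪z.snd, z.fst⟫ = 0 :=
  mem_normalCone_polyCone

theorem isClosed_gph_normalCone_polyCone (s : Finset (Euc k)) :
    IsClosed (gph (normalCone (polyCone s))) := by
  have h1 : Continuous fun z : Prod2 k k => z.fst := by fun_prop
  have h2 : Continuous fun z : Prod2 k k => z.snd := by fun_prop
  have : gph (normalCone (polyCone s)) = (fun z : Prod2 k k => z.fst) ⁻¹' polyCone s ∩
      ((fun z : Prod2 k k => z.snd) ⁻¹' polar (polyCone s) ∩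
        {z : Prod2 k k | ⟪z.snd, z.fst⟫ = 0}) := by
    ext z
    exact mem_gph_normalCone_polyCone
  rw [this]
  exact ((isClosed_polyCone s).preimage h1).inter (((isClosed_polar _).preimage h2).inter
    (isClosed_eq (h2.inner h1) continuous_const))

theorem smul_mem_gph_normalCone_polyCone {s : Finset (Euc k)} {t : ℝ} (ht : 0 < t)
    {z : Prod2 k k} (hz : z ∈ gph (normalCone (polyCone s))) :
    t • z ∈ gph (normalCone (polyCone s)) := by
  rw [mem_gph_normalCone_polyCone] at *
  refine ⟨smul_mem_polyCone ht.le hz.1, fun u hu => ?_, ?_⟩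
  · rw [WithLp.smul_snd, real_inner_smul_left]
    exact mul_nonpos_of_nonneg_of_nonpos ht.le (hz.2.1 u hu)
  · rw [WithLp.smul_snd, WithLp.smul_fst, real_inner_smul_left, real_inner_smul_right, hz.2.2]
    simp

theorem eventually_add_mem_gph_normalCone_iff {D : Set (Euc k)} (hD : IsConvexPolyhedral D)
    {p : Prod2 k k} (hp : p ∈ gph (normalCone D)) :
    ∀ᶠ z in 𝓝 (0 : Prod2 k k), p + z ∈ gph (normalCone D) ↔
      z ∈ gph (normalCone (criticalCone D p.fst p.snd)) := by
  have hc : Continuous fun z : Prod2 k k => (z.fst, z.snd) := by fun_prop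
  exact (hc.tendsto 0).eventually (hD.eventually_mem_normalCone_iff hp)

theorem tangentCone_gph_normalCone {D : Set (Euc k)} (hD : IsConvexPolyhedral D)
    {p : Prod2 k k} (hp : p ∈ gph (normalCone D)) :
    tangentCone (gph (normalCone D)) p =
      gph (normalCone (criticalCone D p.fst p.snd)) := by
  have hloc := eventually_add_mem_gph_normalCone_iff hD hp
  obtain ⟨s, hs⟩ := hD.exists_criticalCone_eq hp.1 p.snd
  rw [hs] at hloc ⊢
  rw [tangentCone_congr (y := 0) (B := gph (normalCone (polyCone s))) (by simpa using hloc)]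
  refine tangentCone_zero_of_cone (isClosed_gph_normalCone_polyCone s) fun t ht z =>
    ⟨fun h => ?_, smul_mem_gph_normalCone_polyCone ht⟩
  simpa [smul_smul, ht.ne'] using smul_mem_gph_normalCone_polyCone (inv_pos.2 ht) h

/-- The graph of `N_D` and its tangent cones near a point of the graph. -/
theorem eventually_tangentCone_gph_normalCone {D : Set (Euc k)} (hD : IsConvexPolyhedral D)
    {p : Prod2 k k} (hp : p ∈ gph (normalCone D)) {s : Finset (Euc k)}
    (hs : criticalCone D p.fst p.snd = polyCone s) :
    ∀ᶠ z in 𝓝 (0 : Prod2 k k),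
      (p + z ∈ gph (normalCone D) ↔ z ∈ gph (normalCone (polyCone s))) ∧
      (p + z ∈ gph (normalCone D) → tangentCone (gph (normalCone D)) (p + z) =
        gph (normalCone (criticalCone (polyCone s) z.fst z.snd))) := by
  have hloc := eventually_add_mem_gph_normalCone_iff hD hp
  rw [hs] at hloc
  filter_upwards [hloc, hloc.eventually_nhds] with z hz hz'
  refine ⟨hz, fun hmem => ?_⟩
  rw [← tangentCone_gph_normalCone (isConvexPolyhedral_polyCone s) (hz.1 hmem)]
  refine tangentCone_congr ?_
  have : Tendsto (fun y => z + y) (𝓝 0) (𝓝 z) := by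
    have : Continuous fun y : Prod2 k k => z + y := by fun_prop
    simpa using this.tendsto 0
  simpa [add_assoc] using this.eventually hz'

theorem eventually_nhdsWithin_tangentCone {D : Set (Euc k)} (hD : IsConvexPolyhedral D)
    {p : Prod2 k k} (hp : p ∈ gph (normalCone D)) {s : Finset (Euc k)}
    (hs : criticalCone D p.fst p.snd = polyCone s) :
    ∀ᶠ q in 𝓝[gph (normalCone D)] p, q - p ∈ gph (normalCone (polyCone s)) ∧
      tangentCone (gph (normalCone D)) q =
        gph (normalCone (criticalCone (polyCone s) (q - p).fst (q - p).snd)) := by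
  have ht : Tendsto (fun q => q - p) (𝓝 p) (𝓝 0) := by
    have : Continuous fun q : Prod2 k k => q - p := by fun_prop
    simpa using this.tendsto p
  filter_upwards [self_mem_nhdsWithin,
    nhdsWithin_le_nhds (ht.eventually (eventually_tangentCone_gph_normalCone hD hp hs))]
    with q hq hz
  rw [add_sub_cancel] at hz
  exact ⟨hz.1.1 hq, hz.2 hq⟩

/-- Near a point of the graph of `N_D` all tangent cones are of the form `gph N_(F₁ - F₂)`. -/
theorem eventually_exists_face {D : Set (Euc k)} (hD : IsConvexPolyhedral D)
    {p : Prod2 k k} (hp : p ∈ gph (normalCone D)) {s : Finset (Euc k)}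
    (hs : criticalCone D p.fst p.snd = polyCone s) :
    ∀ᶠ q in 𝓝[gph (normalCone D)] p, ∃ F₁ F₂, IsFace (polyCone s) F₁ ∧
      IsFace (polyCone s) F₂ ∧ F₂ ⊆ F₁ ∧
      tangentCone (gph (normalCone D)) q = gph (normalCone (F₁ - F₂)) := by
  filter_upwards [eventually_nhdsWithin_tangentCone hD hp hs] with q hq
  obtain ⟨h1, h2, h3⟩ := mem_gph_normalCone_polyCone.1 hq.1
  obtain ⟨F₁, F₂, hF₁, hF₂, h, he⟩ := exists_face_criticalCone h2 h1 h3
  exact ⟨F₁, F₂, hF₁, hF₂, h, by rw [hq.2, he]⟩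

/-- The points p + t z, t ↓ 0, with z = (u, w) realising F₁ - F₂, all have this same tangent cone.
-/
theorem frequently_tangentCone_eq {D : Set (Euc k)} (hD : IsConvexPolyhedral D)
    {p : Prod2 k k} (hp : p ∈ gph (normalCone D)) {s : Finset (Euc k)}
    (hs : criticalCone D p.fst p.snd = polyCone s) {F₁ F₂ : Set (Euc k)}
    (hF₁ : IsFace (polyCone s) F₁) (hF₂ : IsFace (polyCone s) F₂) (h : F₂ ⊆ F₁) :
    ∃ᶠ q in 𝓝[gph (normalCone D)] p, q ∈ gph (normalCone D) ∧
      tangentCone (gph (normalCone D)) q = gph (normalCone (F₁ - F₂)) := by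
  obtain ⟨u, hu, w, hw, hwu, hC⟩ := exists_criticalCone_eq_sub hF₁ hF₂ h
  have hz : (WithLp.toLp 2 (u, w) : Prod2 k k) ∈ gph (normalCone (polyCone s)) :=
    mem_gph_normalCone_polyCone.2 ⟨hu, hw, hwu⟩
  set z : Prod2 k k := WithLp.toLp 2 (u, w) with hzdef
  have h0 : Tendsto (fun t : ℝ => t • z) (𝓝[>] 0) (𝓝 0) := by
    have : Continuous fun t : ℝ => t • z := by fun_prop
    simpa using (this.tendsto 0).mono_left nhdsWithin_le_nhds
  have hev := h0.eventually (eventually_tangentCone_gph_normalCone hD hp hs)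
  have hmem : ∀ᶠ t : ℝ in 𝓝[>] 0, p + t • z ∈ gph (normalCone D) ∧
      tangentCone (gph (normalCone D)) (p + t • z) = gph (normalCone (F₁ - F₂)) := by
    filter_upwards [hev, self_mem_nhdsWithin] with t ht ht0
    have hA := ht.1.2 (smul_mem_gph_normalCone_polyCone ht0 hz)
    refine ⟨hA, (ht.2 hA).trans ?_⟩
    rw [← hC t ht0]
    rfl
  have hlim : Tendsto (fun t : ℝ => p + t • z) (𝓝[>] 0) (𝓝[gph (normalCone D)] p) := by
    refine tendsto_nhdsWithin_iff.2 ⟨?_, hmem.mono fun t ht => ht.1⟩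
    simpa using h0.const_add p
  exact hlim.frequently hmem.frequently

/-! ### Subspaces -/

theorem exists_polyCone_eq_sub {s : Finset (Euc k)} {F₁ F₂ : Set (Euc k)}
    (hF₁ : IsFace (polyCone s) F₁) (hF₂ : IsFace (polyCone s) F₂) (h : F₂ ⊆ F₁) :
    ∃ s' : Finset (Euc k), F₁ - F₂ = polyCone s' := by
  obtain ⟨u, hu, w, _, _, hC⟩ := exists_criticalCone_eq_sub hF₁ hF₂ h
  rw [← hC 1 one_pos]
  exact (isConvexPolyhedral_polyCone s).exists_criticalCone_eq
    (smul_mem_polyCone zero_le_one hu) _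

/-- The zero vector is normal everywhere, so (u, 0) lies in the graph, and a subspace also contains
(-u, 0). -/
theorem neg_mem_of_toSet_eq_gph {s : Finset (Euc k)} {L : Zspace k k}
    (hL : L.toSet = gph (normalCone (polyCone s))) {u : Euc k} (hu : u ∈ polyCone s) :
    -u ∈ polyCone s := by
  have h1 : (WithLp.toLp 2 (u, 0) : Prod2 k k) ∈ L.toSet := by
    rw [hL, mem_gph_normalCone_polyCone]
    exact ⟨hu, fun v _ => by simp, by simp⟩
  have h2 : -(WithLp.toLp 2 (u, 0) : Prod2 k k) ∈ L.toSet := L.1.neg_mem h1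
  rw [hL, mem_gph_normalCone_polyCone] at h2
  exact h2.1

theorem sub_eq_sub_self_of_neg_mem {s : Finset (Euc k)} {F₁ F₂ : Set (Euc k)}
    (hF₁ : IsFace (polyCone s) F₁) (hF₂ : IsFace (polyCone s) F₂) (h : F₂ ⊆ F₁)
    (hneg : ∀ u ∈ F₁ - F₂, -u ∈ F₁ - F₂) : F₁ - F₂ = F₁ - F₁ := by
  refine (Set.sub_subset_sub_left h).antisymm ?_
  rintro _ ⟨f, hf, g, hg, rfl⟩
  -- Since 0 ∈ F₂, symmetry gives -g = a - b with a ∈ F₁ and b ∈ F₂, whence f - g = (f + a) - b.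
  obtain ⟨a, ha, b, hb, hab⟩ := hneg g ⟨g, hg, 0, hF₂.zero_mem, sub_zero g⟩
  refine ⟨f + a, hF₁.add_mem hf ha, b, hb, ?_⟩
  simp only at hab ⊢
  rw [add_sub_assoc, hab, sub_eq_add_neg]

theorem gph_normalCone_of_neg_mem {s : Finset (Euc k)}
    (hneg : ∀ u ∈ polyCone s, -u ∈ polyCone s) :
    gph (normalCone (polyCone s)) = prodSet (polyCone s) (orth (polyCone s)) := by
  ext z
  rw [mem_gph_normalCone_polyCone]
  refine and_congr_right fun hz => ⟨fun h u hu => ?_, fun h => ⟨fun u hu => ?_, ?_⟩⟩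
  · have h1 := h.1 u hu
    have h2 := h.1 (-u) (hneg u hu)
    rw [inner_neg_right] at h2
    rw [real_inner_comm]
    linarith
  · rw [real_inner_comm]
    exact (h u hu).le
  · rw [real_inner_comm]
    exact h _ hz

theorem exists_submodule_eq_polyCone {s : Finset (Euc k)}
    (hneg : ∀ u ∈ polyCone s, -u ∈ polyCone s) :
    ∃ V : Submodule ℝ (Euc k), (V : Set (Euc k)) = polyCone s := by
  refine ⟨⟨⟨⟨polyCone s, add_mem_polyCone⟩, zero_mem_polyCone s⟩, fun c u hu => ?_⟩, rfl⟩
  rcases le_total 0 c with hc | hc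
  · exact smul_mem_polyCone hc hu
  · have := smul_mem_polyCone (neg_nonneg.2 hc) (hneg u hu)
    rwa [smul_neg, neg_smul, neg_neg] at this

theorem orth_coe_submodule {E : Type*} [NormedAddCommGroup E] [InnerProductSpace ℝ E]
    (V : Submodule ℝ E) : orth (V : Set E) = (Vᗮ : Submodule ℝ E) := rfl

theorem exists_zspace_toSet_eq (V : Submodule ℝ (Euc k)) :
    ∃ L : Zspace k k, L.toSet = prodSet (V : Set (Euc k)) (orth V) := by
  refine ⟨⟨(V.prod Vᗮ).comap (WithLp.linearEquiv 2 ℝ (Euc k × Euc k)).toLinearMap, ?_⟩, rfl⟩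
  let e : (V.prod Vᗮ).comap (WithLp.linearEquiv 2 ℝ (Euc k × Euc k)).toLinearMap ≃ₗ[ℝ] V × Vᗮ :=
    { toFun := fun x => (⟨x.1.fst, x.2.1⟩, ⟨x.1.snd, x.2.2⟩)
      invFun := fun y => ⟨WithLp.toLp 2 (y.1.1, y.2.1), y.1.2, y.2.2⟩
      map_add' := fun _ _ => rfl
      map_smul' := fun _ _ => rfl
      left_inv := fun _ => rfl
      right_inv := fun _ => rfl }
  rw [e.finrank_eq, Module.finrank_prod, V.finrank_add_finrank_orthogonal]
  simp

/-! ### Regular coderivatives at smooth points -/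

/-- The polar of V × V^⊥ is V^⊥ × V; swapping the factors, with a harmless sign, returns V × V^⊥. -/
theorem regularCoderiv_eq_gphDeriv_of_subspace (V : Submodule ℝ (Euc k)) :
    {w : Prod2 k k | WithLp.toLp 2 (w.snd, -w.fst) ∈ polar (prodSet (V : Set (Euc k)) (orth V))} =
      prodSet (V : Set (Euc k)) (orth V) := by
  ext w
  rw [orth_coe_submodule]
  constructor
  · intro h
    have h1 : ∀ v ∈ V, ⟪w.snd, v⟫ ≤ 0 := fun v hv => by
      have := h (WithLp.toLp 2 (v, 0)) ⟨hv, Vᗮ.zero_mem⟩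
      simpa [WithLp.prod_inner_apply] using this
    have h2 : ∀ v ∈ Vᗮ, ⟪-w.fst, v⟫ ≤ 0 := fun v hv => by
      have := h (WithLp.toLp 2 (0, v)) ⟨V.zero_mem, hv⟩
      simpa [WithLp.prod_inner_apply] using this
    constructor
    · rw [← V.orthogonal_orthogonal]
      refine (Submodule.mem_orthogonal' _ _).2 fun v hv => ?_
      have a1 := h2 v hv
      have a2 := h2 (-v) (Vᗮ.neg_mem hv)
      simp only [inner_neg_left, inner_neg_right] at a1 a2
      linarith
    · refine (Submodule.mem_orthogonal' _ _).2 fun v hv => ?_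
      have a1 := h1 v hv
      have a2 := h1 (-v) (V.neg_mem hv)
      rw [inner_neg_right] at a2
      linarith
  · rintro ⟨h1, h2⟩ z ⟨hz1, hz2⟩
    have a1 : ⟪w.snd, z.fst⟫ = 0 := (Submodule.mem_orthogonal' _ _).1 h2 _ hz1
    have a2 : ⟪w.fst, z.snd⟫ = 0 := (Submodule.mem_orthogonal _ _).1 hz2 _ h1
    simp [WithLp.prod_inner_apply, a1, a2]

theorem dualHat_eq_primalHat {D : Set (Euc k)} (hD : IsConvexPolyhedral D) :
    dualHat (normalCone D) = primalHat (normalCone D) := by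
  funext p
  ext L
  refine and_congr_right fun hp => ?_
  obtain ⟨hp, L', hL'⟩ := hp
  suffices gphRegularCoderiv (normalCone D) p = gphDeriv (normalCone D) p by rw [this]
  rw [gphDeriv, tangentCone_gph_normalCone hD hp] at *
  obtain ⟨s, hs⟩ := hD.exists_criticalCone_eq hp.1 p.snd
  rw [gphRegularCoderiv, regularNormalCone, tangentCone_gph_normalCone hD hp]
  rw [hs] at hL' ⊢
  have hneg := fun u => neg_mem_of_toSet_eq_gph hL' (u := u)
  obtain ⟨V, hV⟩ := exists_submodule_eq_polyCone hneg
  rw [gph_normalCone_of_neg_mem hneg, ← hV]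
  exact regularCoderiv_eq_gphDeriv_of_subspace V

theorem limitingDual_eq_limitingPrimal {D : Set (Euc k)} (hD : IsConvexPolyhedral D) :
    limitingDual (normalCone D) = limitingPrimal (normalCone D) := by
  funext p
  rw [limitingDual, limitingPrimal, dualHat_eq_primalHat hD]

theorem toSet_injective : Function.Injective (Zspace.toSet (n := k) (m := k)) :=
  fun _ _ h => Subtype.ext (SetLike.coe_injective h)

/-! ### Limiting derivatives, semismoothness* and the outer limiting tangent cone -/

theorem limitingPrimal_normalCone {D : Set (Euc k)} (hD : IsConvexPolyhedral D)
    {p : Prod2 k k} (hp : p ∈ gph (normalCone D)) :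
    limitingPrimal (normalCone D) p =
      {L | ∃ F, IsFace (criticalCone D p.fst p.snd) F ∧
        L.toSet = prodSet (F - F) (orth (F - F))} := by
  obtain ⟨s, hs⟩ := hD.exists_criticalCone_eq hp.1 p.snd
  rw [hs]
  apply Set.Subset.antisymm
  -- Finitely many faces give finitely many subspaces, a closed set that limits cannot leave.
  · refine outerLim_subset_of_eventually (Set.Finite.isClosed ?_) ?_
    · refine (((finite_setOf_isFace_polyCone s).image fun F =>
        (prodSet (F - F) (orth (F - F)) : Set (Prod2 k k))).preimage
          (toSet_injective.injOn)).subset ?_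
      rintro L ⟨F, hF, hL⟩
      exact ⟨F, hF, hL.symm⟩
    · filter_upwards [eventually_exists_face hD hp hs]
      rintro q ⟨F₁, F₂, hF₁, hF₂, h, hq⟩ L ⟨_, hL⟩
      rw [gphDeriv, hq] at hL
      obtain ⟨s', hs'⟩ := exists_polyCone_eq_sub hF₁ hF₂ h
      have hneg : ∀ u ∈ polyCone s', -u ∈ polyCone s' := fun u =>
        neg_mem_of_toSet_eq_gph (hs' ▸ hL)
      refine ⟨F₁, hF₁, ?_⟩
      rw [← sub_eq_sub_self_of_neg_mem hF₁ hF₂ h (by rwa [hs']), hL, hs',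
        gph_normalCone_of_neg_mem hneg]
  · rintro L ⟨F, hF, hL⟩
    obtain ⟨s', hs'⟩ := exists_polyCone_eq_sub hF hF subset_rfl
    have hneg : ∀ u ∈ polyCone s', -u ∈ polyCone s' := by
      rw [← hs']
      rintro _ ⟨f, hf, g, hg, rfl⟩
      exact ⟨g, hg, f, hf, (neg_sub f g).symm⟩
    refine mem_outerLim_of_frequently
      ((frequently_tangentCone_eq hD hp hs hF hF subset_rfl).mono ?_)
    rintro q ⟨hq, hT⟩
    have hLT : L.toSet = gphDeriv (normalCone D) q := by
      rw [gphDeriv, hT, hs', gph_normalCone_of_neg_mem hneg, hL, hs']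
    exact ⟨⟨hq, L, hLT⟩, hLT⟩

theorem exists_toSet_eq_of_isFace {s : Finset (Euc k)} {F : Set (Euc k)}
    (hF : IsFace (polyCone s) F) :
    ∃ L : Zspace k k, L.toSet = prodSet (F - F) (orth (F - F)) := by
  obtain ⟨s', hs'⟩ := exists_polyCone_eq_sub hF hF subset_rfl
  have hneg : ∀ u ∈ polyCone s', -u ∈ polyCone s' := by
    rw [← hs']
    rintro _ ⟨f, hf, g, hg, rfl⟩
    exact ⟨g, hg, f, hf, (neg_sub f g).symm⟩
  obtain ⟨V, hV⟩ := exists_submodule_eq_polyCone hneg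
  rw [hs', ← hV]
  exact exists_zspace_toSet_eq V

theorem image_toSet_limitingPrimal_normalCone {D : Set (Euc k)} (hD : IsConvexPolyhedral D)
    {p : Prod2 k k} (hp : p ∈ gph (normalCone D)) :
    Zspace.toSet '' limitingPrimal (normalCone D) p =
      {X | ∃ F, IsFace (criticalCone D p.fst p.snd) F ∧
        X = prodSet (F - F) (orth (F - F))} := by
  rw [limitingPrimal_normalCone hD hp]
  obtain ⟨s, hs⟩ := hD.exists_criticalCone_eq hp.1 p.snd
  rw [hs]
  ext X
  constructor
  · rintro ⟨L, ⟨F, hF, hL⟩, rfl⟩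
    exact ⟨F, hF, hL⟩
  · rintro ⟨F, hF, rfl⟩
    obtain ⟨L, hL⟩ := exists_toSet_eq_of_isFace hF
    exact ⟨L, ⟨F, hF, hL⟩, hL⟩

theorem isSCDMapping_normalCone {D : Set (Euc k)} (hD : IsConvexPolyhedral D) :
    IsSCDMapping (normalCone D) := by
  intro p hp
  rw [limitingDual_eq_limitingPrimal hD, ← Set.image_nonempty (f := Zspace.toSet),
    image_toSet_limitingPrimal_normalCone hD hp]
  obtain ⟨s, hs⟩ := hD.exists_criticalCone_eq hp.1 p.snd
  rw [hs]
  exact ⟨_, _, isFace_polyCone_self s, rfl⟩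

/-- The inner product in the definition is exactly zero near p: with z = q - p, both z and -z are
tangent to the graph at q. -/
theorem semismoothStarAt_normalCone {D : Set (Euc k)} (hD : IsConvexPolyhedral D)
    {p : Prod2 k k} (hp : p ∈ gph (normalCone D)) : SemismoothStarAt (normalCone D) p := by
  intro ε hε
  obtain ⟨s, hs⟩ := hD.exists_criticalCone_eq hp.1 p.snd
  obtain ⟨δ, hδ, hball⟩ := (Metric.nhds_basis_closedBall.eventually_iff).1
    (eventually_nhdsWithin_iff.1 (eventually_nhdsWithin_tangentCone hD hp hs))
  refine ⟨δ, hδ, fun q hq v hv => ?_⟩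
  obtain ⟨hz, hT⟩ := hball hq.2 hq.1
  rw [regularNormalCone, hT] at hv
  obtain ⟨hu, hw, hwu⟩ := mem_gph_normalCone_polyCone.1 hz
  set z := q - p with hzdef
  have hC := isConvexPolyhedral_polyCone s
  have hu1 : z.fst ∈ criticalCone (polyCone s) z.fst z.snd :=
    ⟨(hC.mem_tangentCone_iff hu).2 ⟨1, one_pos, by simpa using add_mem_polyCone hu hu⟩,
      mem_orth_singleton.2 hwu⟩
  have hu2 : -z.fst ∈ criticalCone (polyCone s) z.fst z.snd :=
    ⟨(hC.mem_tangentCone_iff hu).2 ⟨1, one_pos, by simpa using zero_mem_polyCone s⟩,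
      mem_orth_singleton.2 (by rw [inner_neg_right, hwu, neg_zero])⟩
  have horth : ∀ y ∈ criticalCone (polyCone s) z.fst z.snd, ⟪z.snd, y⟫ = 0 :=
    fun y hy => mem_orth_singleton.1 hy.2
  have h1 : z ∈ gph (normalCone (criticalCone (polyCone s) z.fst z.snd)) :=
    ⟨hu1, fun y hy => by rw [inner_sub_right, horth y hy, hwu, sub_zero]⟩
  have h2 : -z ∈ gph (normalCone (criticalCone (polyCone s) z.fst z.snd)) :=
    ⟨hu2, fun y hy => by
      rw [WithLp.neg_snd, WithLp.neg_fst, inner_neg_left, inner_sub_right, horth y hy,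
        inner_neg_right, hwu]
      simp⟩
  have a1 := hv z h1
  have a2 := hv (-z) h2
  rw [inner_neg_right] at a2
  rw [show ⟪v, z⟫ = 0 by linarith, abs_zero]
  positivity

theorem outerLimitingTangentCone_gph_normalCone {D : Set (Euc k)} (hD : IsConvexPolyhedral D)
    {p : Prod2 k k} (hp : p ∈ gph (normalCone D)) :
    outerLimitingTangentCone (gph (normalCone D)) p =
      {z | ∃ F₁ F₂ : Set (Euc k), IsFace (criticalCone D p.fst p.snd) F₁ ∧
        IsFace (criticalCone D p.fst p.snd) F₂ ∧ F₂ ⊆ F₁ ∧ z ∈ gph (normalCone (F₁ - F₂))} := by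
  obtain ⟨s, hs⟩ := hD.exists_criticalCone_eq hp.1 p.snd
  rw [hs]
  apply Set.Subset.antisymm
  · refine outerLim_subset_of_eventually ?_ ?_
    -- The right-hand side is a finite union of closed graphs, hence closed.
    · have hfin : {P : Set (Euc k) × Set (Euc k) | IsFace (polyCone s) P.1 ∧
          IsFace (polyCone s) P.2 ∧ P.2 ⊆ P.1}.Finite :=
        ((finite_setOf_isFace_polyCone s).prod (finite_setOf_isFace_polyCone s)).subset
          fun P hP => ⟨hP.1, hP.2.1⟩
      have hU : {z | ∃ F₁ F₂ : Set (Euc k), IsFace (polyCone s) F₁ ∧ IsFace (polyCone s) F₂ ∧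
          F₂ ⊆ F₁ ∧ z ∈ gph (normalCone (F₁ - F₂))} =
          ⋃ P ∈ {P : Set (Euc k) × Set (Euc k) | IsFace (polyCone s) P.1 ∧
            IsFace (polyCone s) P.2 ∧ P.2 ⊆ P.1}, gph (normalCone (P.1 - P.2)) := by
        ext z
        simp [and_assoc]
      rw [hU]
      refine hfin.isClosed_biUnion ?_
      rintro ⟨F₁, F₂⟩ ⟨hF₁, hF₂, h⟩
      obtain ⟨s', hs'⟩ := exists_polyCone_eq_sub hF₁ hF₂ h
      simp only at hs' ⊢
      rw [hs']
      exact isClosed_gph_normalCone_polyCone s'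
    · filter_upwards [eventually_exists_face hD hp hs]
      rintro q ⟨F₁, F₂, hF₁, hF₂, h, hq⟩ z hz
      exact ⟨F₁, F₂, hF₁, hF₂, h, hq ▸ hz⟩
  · rintro z ⟨F₁, F₂, hF₁, hF₂, h, hz⟩
    refine mem_outerLim_of_frequently ((frequently_tangentCone_eq hD hp hs hF₁ hF₂ h).mono ?_)
    rintro q ⟨_, hq⟩
    rwa [hq]

end SCD

theorem proposition5p3 (k : ℕ) (D : Set (Euc k)) (hD : IsConvexPolyhedral D) :
    IsSCDMapping (normalCone D) ∧
    (∀ p ∈ gph (normalCone D), SemismoothStarAt (normalCone D) p) ∧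
    ∀ d d' : Euc k, d' ∈ normalCone D d →
      Zspace.toSet '' limitingPrimal (normalCone D) (WithLp.toLp 2 (d, d')) =
        {X | ∃ F : Set (Euc k), IsFace (criticalCone D d d') F ∧
          X = prodSet (F - F) (orth (F - F))} ∧
      Zspace.toSet '' limitingDual (normalCone D) (WithLp.toLp 2 (d, d')) =
        {X | ∃ F : Set (Euc k), IsFace (criticalCone D d d') F ∧
          X = prodSet (F - F) (orth (F - F))} ∧
      outerLimitingTangentCone (gph (normalCone D)) (WithLp.toLp 2 (d, d')) =
        {z | ∃ F₁ F₂ : Set (Euc k), IsFace (criticalCone D d d') F₁ ∧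
          IsFace (criticalCone D d d') F₂ ∧ F₂ ⊆ F₁ ∧ z ∈ gph (normalCone (F₁ - F₂))} := by
  refine ⟨isSCDMapping_normalCone hD, fun p hp => semismoothStarAt_normalCone hD hp,
    fun d d' hd => ?_⟩
  have hp : (WithLp.toLp 2 (d, d') : Prod2 k k) ∈ gph (normalCone D) := hd
  refine ⟨image_toSet_limitingPrimal_normalCone hD hp, ?_,
    outerLimitingTangentCone_gph_normalCone hD hp⟩
  rw [limitingDual_eq_limitingPrimal hD]
  exact image_toSet_limitingPrimal_normalCone hD hp
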